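/- Group testing: there are $N$ items, of which $K$ are defective; the defective set $\mathcal K$ is uniformly distributed over the $K$-element subsets of the items. There are $T$ tests. In the Bernoulli$(p)$ design, each item $i$ is included in each test $t$ with probability $p$ (written $x_{it}=1$; otherwise $x_{it}=0$), independently over all pairs $(i,t)$ and independently of $\mathcal K$. The outcome $y_t$ of test $t$ is $1$ if the test contains at least one defective item and $0$ otherwise. Let $\mathcal{PD}$ (the possible defectives) be the set of items $i$ such that there is no test $t$ with $x_{it}=1$ and $y_t=0$. The DD (definite defectives) algorithm estimates $\mathcal K$ by $$\mathcal{DD}=\{i\in\mathcal{PD}:\ \text{for some test } t,\ x_{it}=1,\ y_t=1 \text{ and } x_{jt}=0 \text{ for all } j\in\mathcal{PD}\setminus\{i\}\},$$ and its success probability is $\mathbb P(\mathcal{DD}=\mathcal K)$, over the random design and the random defective set. **Theorem.** Let $0<\beta<1$, write $k(\beta)=\max\{\beta,1-\beta\}$, and fix $\delta>0$. For each $N$ let $K=K_N$ be $N^{1-\beta}$ rounded (up or down) to an integer, and let $T=T_N$ be $(k(\beta)+\delta)\,e\,K\ln N$ rounded (up or down) to an integer; that is, $K_N$ and $T_N$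 are nonnegative integers with $|K_N-N^{1-\beta}|<1$ and $|T_N-(k(\beta)+\delta)\,e\,K_N\ln N|<1$. Then the success probability of the DD algorithm with the Bernoulli$(1/K_N)$ test design with $T_N$ tests tends to $1$ as $N\to\infty$. -/

import Mathlib

open Filter Topology MeasureTheory ProbabilityTheory
open scoped unitInterval

/-- A testing matrix for `N` items and `T` tests: `X i t = true` iff item `i` is in test `t`. -/
abbrev TestMatrix (N T : ℕ) : Type := Fin N → Fin T → Bool

/-- The vector of test outcomes: test `t` is positive iff it contains at least one item of the
defective set `D`. -/
def outcome {N T : ℕ} (X : TestMatrix N T) (D : Finset (Fin N)) : Fin T → Bool :=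
  fun t => decide (∃ i ∈ D, X i t = true)

/-- The guaranteed not-defective items: those which appear in some negative test. -/
def notDefective {N T : ℕ} (X : TestMatrix N T) (y : Fin T → Bool) : Finset (Fin N) :=
  Finset.univ.filter fun i => ∃ t, X i t = true ∧ y t = false

/-- The possible defectives: the items which are not guaranteed to be not defective. -/
def possibleDefectives {N T : ℕ} (X : TestMatrix N T) (y : Fin T → Bool) : Finset (Fin N) :=
  (notDefective X y)ᶜ

/-- The estimate of the `DD` (definite defectives) algorithm: the possible defectives `i` for which
some positive test contains `i` and no other possible defective. -/
def ddEstimate {N T : ℕ} (X : TestMatrix N T) (y : Fin T → Bool) : Finset (Fin N) :=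
  (possibleDefectives X y).filter fun i =>
    ∃ t, X i t = true ∧ (∀ j ∈ possibleDefectives X y \ {i}, X j t = false) ∧ y t = true

/-- The law of the Bernoulli(`p`) test design: the entries of the matrix are independent, each
being `true` with probability `p` and `false` with probability `1 - p`. -/
noncomputable def bernoulliDesign (N T : ℕ) (p : I) : Measure (TestMatrix N T) :=
  Measure.pi fun _ => Measure.pi fun _ => bernoulliMeasure true false p

/-- The average error probability of a detection algorithm (which computes an estimate of the
defective set from the testing matrix and the outcomes) with a Bernoulli(`p`) design, the defective
set being uniform among the `K`-element sets of items. -/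
noncomputable def averageErrorProb {N T : ℕ}
    (alg : TestMatrix N T → (Fin T → Bool) → Finset (Fin N)) (K : ℕ) (p : I) : ℝ :=
  (1 / (N.choose K : ℝ)) * ∑ D ∈ Finset.powersetCard K (Finset.univ : Finset (Fin N)),
    (bernoulliDesign N T p).real {X | alg X (outcome X D) ≠ D}

/-- The success probability of a detection algorithm. -/
noncomputable def successProb {N T : ℕ}
    (alg : TestMatrix N T → (Fin T → Bool) → Finset (Fin N)) (K : ℕ) (p : I) : ℝ :=
  1 - averageErrorProb alg K p

/-- The probability `1 / K` (which is only used for `K ≥ 1`). -/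
noncomputable def oneDiv (K : ℕ) : I :=
  ⟨1 / (K : ℝ), by positivity, by rw [one_div]; exact Nat.cast_inv_le_one K⟩

/-! Fix a defective set of size `K` and put `p = 1/K`, `q = (1-p)^K → 1/e`. DD never reports a
non-defective item (`ddEstimate_subset`), so it errs only by missing a defective `i`. A
non-defective item stays possible with probability `(1-pq)^T`, so by Markov more than `ηK` of them
stay possible with probability at most `N/(ηK) * (1-pq)^T`. If at most `ηK` stay, a test isolates
`i` among the possible defectives with probability at least `pq(1-η)`.

The difficulty is that the possible defectives depend on the tests themselves. They depend only on
the negative columns, however, and given those the positive columns are still independent;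
`sum_prod_good_bad_le` makes this exact without conditional probabilities.

A union bound gives error at most `(N/(ηK) + K) * exp(-q(1-η)T/K)`. The prefactor has order `N^β +
N^(1-β)`, hence at most `N^max(β, 1-β)`, and for small `η` the chosen `T` makes the exponential
smaller by a power of `N`. -/

open scoped Classical in
/-- If the columns `X t` are independent with law `w`, and `bad` is a property of a column that may
depend on the set of negative columns that occur, then the probability that all non-negative
columns are bad, while that set is good, is bounded as if that set were fixed. -/
theorem sum_prod_good_bad_le {ι C : Type*} [Fintype ι] [Fintype C]
    (w : C → ℝ) (hw : ∀ c, 0 ≤ w c) (neg : C → Prop) (good : Finset C → Prop)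
    (bad : Finset C → C → Prop) (b : ℝ) (hb0 : 0 ≤ b)
    (hb : ∀ R, good R → (∀ c ∈ R, neg c) →
      ∑ c with ¬ neg c ∧ bad R c, w c ≤ b) :
    ∑ X : ι → C with good ((Finset.univ.image X).filter neg) ∧
        ∀ t, ¬ neg (X t) → bad ((Finset.univ.image X).filter neg) (X t), ∏ t, w (X t)
      ≤ ((∑ c with neg c, w c) + b) ^ Fintype.card ι := by
  -- Binomial expansion over subsets `Z` of `ι`, matched with the fibres on which `Z` is exactly the
  -- set of negative positions.
  rw [← Fintype.sum_pow_mul_eq_add_pow ι,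
    ← Finset.sum_fiberwise _ (fun X : ι → C => Finset.univ.filter fun t => neg (X t))]
  refine Finset.sum_le_sum fun Z _ => ?_
  rw [Finset.filter_filter, Finset.sum_filter,
    ← (Equiv.piEquivPiSubtypeProd (· ∈ Z) fun _ => C).symm.sum_comp, Fintype.sum_prod_type]
  -- On such a fibre the negative columns are the image of `u`, so the condition on `v` splits into
  -- separate conditions on its entries.
  have key : ∀ (u : {t // t ∈ Z} → C) (v : {t // t ∉ Z} → C),
      (if (good ((Finset.univ.image
          ((Equiv.piEquivPiSubtypeProd (· ∈ Z) fun _ => C).symm (u, v))).filter neg) ∧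
        ∀ t, ¬ neg ((Equiv.piEquivPiSubtypeProd (· ∈ Z) fun _ => C).symm (u, v) t) →
          bad ((Finset.univ.image
            ((Equiv.piEquivPiSubtypeProd (· ∈ Z) fun _ => C).symm (u, v))).filter neg)
            ((Equiv.piEquivPiSubtypeProd (· ∈ Z) fun _ => C).symm (u, v) t)) ∧
        (Finset.univ.filter fun t =>
          neg ((Equiv.piEquivPiSubtypeProd (· ∈ Z) fun _ => C).symm (u, v) t)) = Z
      then ∏ t, w ((Equiv.piEquivPiSubtypeProd (· ∈ Z) fun _ => C).symm (u, v) t) else 0) ≤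
      if (∀ t, neg (u t)) ∧ good (Finset.univ.image u) then
        (∏ t, w (u t)) *
          ∏ t, if ¬ neg (v t) ∧ bad (Finset.univ.image u) (v t) then w (v t) else 0
      else 0 := by
    intro u v
    set X := (Equiv.piEquivPiSubtypeProd (· ∈ Z) fun _ => C).symm (u, v) with hX
    have hu : ∀ t : {t // t ∈ Z}, X t = u t := fun t => by
      simp [hX, Equiv.piEquivPiSubtypeProd]
    have hv : ∀ t : {t // t ∉ Z}, X t = v t := fun t => by
      simp [hX, Equiv.piEquivPiSubtypeProd, t.2]
    have hnn : 0 ≤ if (∀ t, neg (u t)) ∧ good (Finset.univ.image u) then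
        (∏ t, w (u t)) *
          ∏ t, (if ¬ neg (v t) ∧ bad (Finset.univ.image u) (v t) then w (v t) else 0)
        else 0 := by
      split_ifs
      · refine mul_nonneg (Finset.prod_nonneg fun _ _ => hw _) (Finset.prod_nonneg fun t _ => ?_)
        split_ifs
        exacts [hw _, le_rfl]
      · exact le_rfl
    refine (em _).elim (fun h => (if_pos h).trans_le ?_) fun h => (if_neg h).trans_le hnn
    obtain ⟨⟨hg, hbad⟩, hZ⟩ := h
    have hmem : ∀ t, neg (X t) ↔ t ∈ Z := fun t => by rw [← hZ]; simp
    have him : (Finset.univ.image X).filter neg = Finset.univ.image u := by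
      ext c
      simp only [Finset.mem_filter, Finset.mem_image, Finset.mem_univ, true_and]
      constructor
      · rintro ⟨⟨t, rfl⟩, hc⟩
        exact ⟨⟨t, (hmem t).1 hc⟩, (hu ⟨t, (hmem t).1 hc⟩).symm⟩
      · rintro ⟨t, rfl⟩
        rw [← hu t]
        exact ⟨⟨t, rfl⟩, (hmem t).2 t.2⟩
    rw [him] at hg hbad
    rw [if_pos ⟨fun t => by rw [← hu t]; exact (hmem t).2 t.2, hg⟩]
    refine le_of_eq ?_
    rw [← Fintype.prod_subtype_mul_prod_subtype (· ∈ Z) fun t => w (X t)]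
    congr 1
    · exact Finset.prod_congr (by ext; simp) fun t _ => by rw [hu]
    · refine Finset.prod_congr rfl fun t _ => ?_
      have hn : ¬ neg (X t) := fun h => t.2 ((hmem t).1 h)
      rw [if_pos ⟨by rwa [← hv], by rw [← hv]; exact hbad t hn⟩, hv]
  refine (Finset.sum_le_sum fun u _ => Finset.sum_le_sum fun v _ => key u v).trans ?_
  have step : ∀ u : {t // t ∈ Z} → C,
      (∑ v : {t // t ∉ Z} → C, if (∀ t, neg (u t)) ∧ good (Finset.univ.image u) then
        (∏ t, w (u t)) *
          ∏ t, (if ¬ neg (v t) ∧ bad (Finset.univ.image u) (v t) then w (v t) else 0)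
        else 0) ≤
      (∏ t, if neg (u t) then w (u t) else 0) * b ^ (Fintype.card ι - Z.card) := by
    intro u
    have hnn : 0 ≤ ∏ t, if neg (u t) then w (u t) else 0 :=
      Finset.prod_nonneg fun t _ => by split_ifs; exacts [hw _, le_rfl]
    by_cases h : (∀ t, neg (u t)) ∧ good (Finset.univ.image u)
    · simp only [if_pos h]
      rw [← Finset.mul_sum, ← Fintype.prod_sum fun (_ : {t // t ∉ Z}) c =>
        if ¬ neg c ∧ bad (Finset.univ.image u) c then w c else 0]
      simp only [if_pos (h.1 _)]
      refine mul_le_mul_of_nonneg_left ?_ (Finset.prod_nonneg fun _ _ => hw _)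
      rw [Finset.prod_const, ← Finset.sum_filter, Finset.card_univ, Fintype.card_subtype_compl,
        Fintype.card_coe]
      refine pow_le_pow_left₀ (Finset.sum_nonneg fun c _ => hw c) (hb _ h.2 fun c hc => ?_) _
      obtain ⟨t, -, rfl⟩ := Finset.mem_image.1 hc
      exact h.1 t
    · simp only [if_neg h, Finset.sum_const_zero]
      positivity
  refine (Finset.sum_le_sum fun u _ => step u).trans (le_of_eq ?_)
  rw [← Finset.sum_mul, ← Fintype.prod_sum fun (_ : {t // t ∈ Z}) c => if neg c then w c else 0,
    Finset.prod_const, ← Finset.sum_filter, Finset.card_univ, Fintype.card_coe]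

/-! ### The Bernoulli design as independent columns -/

/-- The weight of a column (the set of items of one test) in the Bernoulli(`p`) design. -/
noncomputable def columnWeight {N : ℕ} (p : ℝ) (c : Fin N → Bool) : ℝ :=
  ∏ i, if c i = true then p else 1 - p

lemma columnWeight_nonneg {N : ℕ} {p : ℝ} (hp0 : 0 ≤ p) (hp1 : p ≤ 1) (c : Fin N → Bool) :
    0 ≤ columnWeight p c :=
  Finset.prod_nonneg fun i _ => by split_ifs <;> linarith

-- The matrix is transposed because the argument conditions on whole tests, whereas the design is a
-- product over items.
open scoped Classical in
lemma bernoulliDesign_real {N T : ℕ} (p : I) (S : Set (TestMatrix N T)) :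
    (bernoulliDesign N T p).real S =
      ∑ Y : Fin T → Fin N → Bool with (fun i t => Y t i) ∈ S, ∏ t, columnWeight p (Y t) := by
  have hsing : ∀ X : TestMatrix N T, (bernoulliDesign N T p).real {X} =
      ∏ i, ∏ t, if X i t = true then (p : ℝ) else 1 - p := by
    intro X
    simp only [bernoulliDesign, measureReal_def, Measure.pi_singleton, ENNReal.toReal_prod]
    refine Finset.prod_congr rfl fun i _ => Finset.prod_congr rfl fun t _ => ?_
    rw [← measureReal_def]
    cases X i t <;> simp
  have : IsProbabilityMeasure (bernoulliDesign N T p) := by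
    unfold bernoulliDesign; infer_instance
  have hS : S = ((Finset.univ.filter (· ∈ S) : Finset (TestMatrix N T)) : Set _) := by simp
  conv_lhs => rw [hS]
  rw [← sum_measureReal_singleton, Finset.sum_filter, Finset.sum_filter]
  refine Fintype.sum_equiv (Equiv.piComm fun _ _ => Bool) _ _ fun X => ?_
  simp only [hsing, columnWeight, Equiv.piComm_apply, Function.swap]
  rw [Finset.prod_comm]

lemma sum_columnWeight_cylinder {N : ℕ} (p : ℝ) {A B : Finset (Fin N)} (hAB : Disjoint A B) :
    ∑ c : Fin N → Bool with (∀ j ∈ B, c j = true) ∧ ∀ j ∈ A, c j = false, columnWeight p c =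
      p ^ B.card * (1 - p) ^ A.card := by
  have h : ∀ c : Fin N → Bool, (if (∀ j ∈ B, c j = true) ∧ ∀ j ∈ A, c j = false
      then columnWeight p c else 0) =
      ∏ j, if (j ∈ B → c j = true) ∧ (j ∈ A → c j = false) then
        (if c j = true then p else 1 - p) else 0 := by
    intro c
    rw [Finset.prod_ite_zero, columnWeight]
    congr 1
    simp [forall_and]
  rw [Finset.sum_filter, Finset.sum_congr rfl fun c _ => h c, ← Fintype.prod_sum fun j (b : Bool) =>
    if (j ∈ B → b = true) ∧ (j ∈ A → b = false) then (if b = true then p else 1 - p) else 0]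
  have h2 : ∀ j, (∑ b : Bool, if (j ∈ B → b = true) ∧ (j ∈ A → b = false) then
      (if b = true then p else 1 - p) else 0) =
      (if j ∈ B then p else 1) * if j ∈ A then 1 - p else 1 := by
    intro j
    by_cases hB : j ∈ B
    · simp [hB, Finset.disjoint_right.1 hAB hB]
    · by_cases hA : j ∈ A <;> simp [hA, hB]
  rw [Finset.prod_congr rfl fun j _ => h2 j, Finset.prod_mul_distrib]
  simp [Finset.prod_ite_mem]

lemma sum_columnWeight {N : ℕ} (p : ℝ) : ∑ c : Fin N → Bool, columnWeight p c = 1 := by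
  simpa using sum_columnWeight_cylinder (N := N) p (Finset.disjoint_empty_left ∅)

/-! ### Errors of DD for a fixed defective set -/

section Algorithm

variable {N T : ℕ}

lemma mem_possibleDefectives_outcome {X : TestMatrix N T} {D : Finset (Fin N)} {j : Fin N} :
    j ∈ possibleDefectives X (outcome X D) ↔
      ∀ t, ¬ (X j t = true ∧ ∀ i ∈ D, X i t = false) := by
  simp [possibleDefectives, notDefective, outcome]

lemma subset_possibleDefectives (X : TestMatrix N T) (D : Finset (Fin N)) :
    D ⊆ possibleDefectives X (outcome X D) := fun i hi => by
  rw [mem_possibleDefectives_outcome]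
  rintro t ⟨h1, h2⟩
  simp [h2 i hi] at h1

/-- A positive test contains a defective item, which is always a possible defective; a sole possible
defective in the test must therefore be that item. -/
lemma ddEstimate_subset (X : TestMatrix N T) (D : Finset (Fin N)) :
    ddEstimate X (outcome X D) ⊆ D := fun i hi => by
  obtain ⟨-, t, -, hPD, hpos⟩ := Finset.mem_filter.1 hi
  obtain ⟨k, hk, hkt⟩ := of_decide_eq_true hpos
  by_contra hiD
  have := hPD k (Finset.mem_sdiff.2 ⟨subset_possibleDefectives X D hk, by
    rw [Finset.mem_singleton]; rintro rfl; exact hiD hk⟩)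
  simp [hkt] at this

/-- The probability that a given non-defective item is a possible defective. -/
lemma bernoulliDesign_real_mem_possibleDefectives (p : I) (D : Finset (Fin N)) {j : Fin N}
    (hj : j ∉ D) :
    (bernoulliDesign N T p).real {X | j ∈ possibleDefectives X (outcome X D)} =
      (1 - p * (1 - p) ^ D.card) ^ T := by
  classical
  have hc : ∑ c : Fin N → Bool with ¬ (c j = true ∧ ∀ i ∈ D, c i = false), columnWeight p c =
      1 - p * (1 - p) ^ D.card := by
    have h1 := Finset.sum_filter_add_sum_filter_not Finset.univ
      (fun c : Fin N → Bool => c j = true ∧ ∀ i ∈ D, c i = false) (columnWeight (p : ℝ))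
    have h2 := sum_columnWeight_cylinder (p : ℝ) (Finset.disjoint_singleton_right.2 hj)
    simp only [Finset.mem_singleton, forall_eq, Finset.card_singleton, pow_one] at h2
    rw [sum_columnWeight, h2] at h1
    linarith
  rw [bernoulliDesign_real, ← hc, Finset.sum_filter, Finset.sum_filter, ← Fin.prod_const,
    Fintype.prod_sum]
  refine Finset.sum_congr rfl fun Y _ => ?_
  rw [Finset.prod_ite_zero]
  congr 1
  simp [mem_possibleDefectives_outcome]

/-- There are unlikely to be many non-defective possible defectives. -/
lemma bernoulliDesign_real_lt_card_le (p : I) (D : Finset (Fin N)) {a : ℝ} (ha : 0 < a) :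
    (bernoulliDesign N T p).real
        {X | a < ((possibleDefectives X (outcome X D) \ D).card : ℝ)} ≤
      N / a * (1 - p * (1 - p) ^ D.card) ^ T := by
  classical
  have hw : ∀ Y : Fin T → Fin N → Bool, 0 ≤ ∏ t, columnWeight (p : ℝ) (Y t) := fun Y =>
    Finset.prod_nonneg fun t _ => columnWeight_nonneg p.2.1 p.2.2 _
  -- Markov's inequality, by exchanging the sums over items and matrices.
  have h1 : (bernoulliDesign N T p).real
      {X | a < ((possibleDefectives X (outcome X D) \ D).card : ℝ)} ≤
      ∑ j ∈ Dᶜ, (bernoulliDesign N T p).real {X | j ∈ possibleDefectives X (outcome X D)} / a := by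
    simp only [bernoulliDesign_real]
    rw [← Finset.sum_div, le_div_iff₀ ha]
    simp only [Finset.sum_filter, Set.mem_ofPred_eq]
    rw [Finset.sum_comm, Finset.sum_mul]
    refine Finset.sum_le_sum fun Y _ => ?_
    rw [← Finset.sum_filter, Finset.sum_const, nsmul_eq_mul]
    have hcard : (Dᶜ.filter fun j => j ∈ possibleDefectives (fun i t => Y t i)
        (outcome (fun i t => Y t i) D)) = possibleDefectives (fun i t => Y t i)
        (outcome (fun i t => Y t i) D) \ D := by
      ext j; simp [and_comm]
    rw [hcard]
    split_ifs with h
    · rw [mul_comm]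
      exact mul_le_mul_of_nonneg_right h.le (hw Y)
    · rw [zero_mul]
      exact mul_nonneg (Nat.cast_nonneg _) (hw Y)
  refine h1.trans ?_
  rw [Finset.sum_congr rfl fun j hj => by
    rw [bernoulliDesign_real_mem_possibleDefectives p D (Finset.mem_compl.1 hj)],
    Finset.sum_const, nsmul_eq_mul, div_eq_mul_inv, ← mul_assoc, div_eq_mul_inv,
    mul_right_comm]
  have hN : ((Dᶜ).card : ℝ) ≤ N := by
    exact_mod_cast (Finset.card_le_univ _).trans (Fintype.card_fin N).le
  have : 0 ≤ 1 - (p : ℝ) * (1 - p) ^ D.card := by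
    have := mul_le_one₀ p.2.2 (pow_nonneg (sub_nonneg.2 p.2.2) D.card)
      (pow_le_one₀ (sub_nonneg.2 p.2.2) (sub_le_self 1 p.2.1))
    linarith
  gcongr

/-- A given defective item is unlikely to be missed when there are few non-defective possible
defectives. -/
lemma bernoulliDesign_real_notMem_ddEstimate_le (p : I) (D : Finset (Fin N)) {i : Fin N}
    (hi : i ∈ D) {a : ℝ} (ha : 0 ≤ a) :
    (bernoulliDesign N T p).real
        {X | ((possibleDefectives X (outcome X D) \ D).card : ℝ) ≤ a ∧
          i ∉ ddEstimate X (outcome X D)} ≤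
      (1 - p * (1 - p) ^ D.card * (1 - p * a)) ^ T := by
  classical
  have hp0 : (0 : ℝ) ≤ p := p.2.1
  have hp1 : (p : ℝ) ≤ 1 := p.2.2
  have hw : ∀ c : Fin N → Bool, 0 ≤ columnWeight (p : ℝ) c := columnWeight_nonneg hp0 hp1
  let neg : (Fin N → Bool) → Prop := fun c => ∀ k ∈ D, c k = false
  -- `R` plays the role of the set of negative columns, which alone determines the possible
  -- defectives.
  let PD : Finset (Fin N → Bool) → Finset (Fin N) := fun R =>
    Finset.univ.filter fun j => ∀ c ∈ R, c j = false
  let good : Finset (Fin N → Bool) → Prop := fun R => ((PD R \ D).card : ℝ) ≤ a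
  let sole : Finset (Fin N → Bool) → (Fin N → Bool) → Prop := fun R c =>
    c i = true ∧ ∀ j ∈ (D ∪ PD R) \ {i}, c j = false
  have hneg : ∑ c with neg c, columnWeight (p : ℝ) c = (1 - p) ^ D.card := by
    simpa using sum_columnWeight_cylinder (p : ℝ) (Finset.disjoint_empty_right D)
  have hq0 : 0 ≤ (1 - (p : ℝ)) ^ D.card := pow_nonneg (by linarith) _
  have hsole : ∀ R, good R →
      p * (1 - p) ^ D.card * (1 - p * a) ≤ ∑ c with sole R c, columnWeight (p : ℝ) c := by
    intro R hR
    have h := sum_columnWeight_cylinder (p : ℝ)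
      (A := (D ∪ PD R) \ {i}) (B := {i}) Finset.sdiff_disjoint
    simp only [Finset.mem_singleton, forall_eq, Finset.card_singleton, pow_one] at h
    refine le_of_le_of_eq ?_ h.symm
    -- The saving of one from removing `i` is given up; Bernoulli's inequality then handles the
    -- power `(PD R \ D).card`.
    have hcard : ((D ∪ PD R) \ {i}).card ≤ D.card + (PD R \ D).card :=
      (Finset.card_le_card Finset.sdiff_subset).trans
        (by rw [← Finset.union_sdiff_self_eq_union]; exact Finset.card_union_le _ _)
    rw [mul_assoc]
    refine mul_le_mul_of_nonneg_left ?_ hp0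
    refine le_trans ?_ (pow_le_pow_of_le_one (by linarith) (by linarith) hcard)
    rw [pow_add]
    refine mul_le_mul_of_nonneg_left ?_ hq0
    have hb := one_add_mul_le_pow (a := -(p : ℝ)) (by linarith) (PD R \ D).card
    have : (p : ℝ) * (PD R \ D).card ≤ p * a := mul_le_mul_of_nonneg_left hR hp0
    rw [← sub_eq_add_neg] at hb
    linarith
  have hb : ∀ R, good R → (∀ c ∈ R, neg c) →
      ∑ c with ¬ neg c ∧ ¬ sole R c, columnWeight (p : ℝ) c ≤
        1 - (1 - p) ^ D.card - p * (1 - p) ^ D.card * (1 - p * a) := by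
    intro R hR _
    have htot : ∑ c with ¬ neg c ∧ ¬ sole R c, columnWeight (p : ℝ) c +
        ∑ c with neg c, columnWeight (p : ℝ) c + ∑ c with sole R c, columnWeight (p : ℝ) c ≤
        1 := by
      rw [← sum_columnWeight (N := N) (p : ℝ), Finset.sum_filter, Finset.sum_filter,
        Finset.sum_filter, ← Finset.sum_add_distrib, ← Finset.sum_add_distrib]
      refine Finset.sum_le_sum fun c _ => ?_
      have : sole R c → ¬ neg c := fun h h' => by
        have := h.1
        simp [h' i hi] at this
      by_cases h1 : neg c <;> by_cases h2 : sole R c <;> simp_all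
    have := hsole R hR
    linarith
  have hb0 : 0 ≤ 1 - (1 - (p : ℝ)) ^ D.card - p * (1 - p) ^ D.card * (1 - p * a) := by
    -- Since `D` is nonempty, one factor `1 - p` can be split off, and `(1 - p)(1 + p) ≤ 1`.
    obtain ⟨k, hk⟩ := Nat.exists_eq_succ_of_ne_zero (Finset.card_ne_zero_of_mem hi)
    have h1 : (p : ℝ) * (1 - p) ^ D.card * (1 - p * a) ≤ p * (1 - p) ^ D.card :=
      mul_le_of_le_one_right (by positivity) (by nlinarith)
    have h2 : (1 - (p : ℝ)) ^ k ≤ 1 := pow_le_one₀ (by linarith) (by linarith)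
    have h3 : 0 ≤ (1 - (p : ℝ)) ^ k := pow_nonneg (by linarith) _
    rw [hk, pow_succ] at *
    nlinarith [mul_nonneg h3 (sq_nonneg (p : ℝ))]
  have main := sum_prod_good_bad_le (ι := Fin T) (columnWeight (p : ℝ)) hw neg good
    (fun R c => ¬ sole R c) _ hb0 fun R h h' => by convert hb R h h'
  rw [Fintype.card_fin] at main
  rw [bernoulliDesign_real]
  refine le_trans (Finset.sum_le_sum_of_subset_of_nonneg ?_ fun Y _ _ =>
    Finset.prod_nonneg fun t _ => hw _) (main.trans (le_of_eq ?_))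
  swap
  · have h : ∀ x : ℝ, x = (1 - p) ^ D.card →
        x + (1 - (1 - (p : ℝ)) ^ D.card - p * (1 - p) ^ D.card * (1 - p * a)) =
          1 - p * (1 - p) ^ D.card * (1 - p * a) := by
      rintro x rfl; ring
    rw [h _ (by convert hneg)]
  intro Y hY
  simp only [Finset.mem_filter, Finset.mem_univ, true_and, Set.mem_ofPred_eq] at hY ⊢
  have hPD : ∀ R : Finset (Fin N → Bool), (∀ c, c ∈ R ↔ (∃ t, Y t = c) ∧ neg c) →
      PD R = possibleDefectives (fun i t => Y t i) (outcome (fun i t => Y t i) D) := by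
    intro R hR
    ext j
    simp only [PD, hR, neg, mem_possibleDefectives_outcome, Finset.mem_filter,
      Finset.mem_univ, true_and]
    constructor
    · rintro h t ⟨h1, h2⟩
      simp [h _ ⟨⟨t, rfl⟩, h2⟩] at h1
    · rintro h _ ⟨⟨t, rfl⟩, h2⟩
      by_contra h3
      exact h t ⟨by simpa using h3, h2⟩
  suffices h : ∀ R : Finset (Fin N → Bool), (∀ c, c ∈ R ↔ (∃ t, Y t = c) ∧ neg c) →
      good R ∧ ∀ t, ¬ neg (Y t) → ¬ sole R (Y t) from h _ (by simp)
  intro R hR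
  specialize hPD R hR
  refine ⟨by simpa only [good, hPD] using hY.1, fun t _ hs => hY.2 ?_⟩
  have hsub := subset_possibleDefectives (fun i t => Y t i) D
  simp only [sole, hPD, Finset.union_eq_right.2 hsub] at hs
  exact Finset.mem_filter.2 ⟨hsub hi, t, hs.1, hs.2, decide_eq_true ⟨i, hi, hs.1⟩⟩

/-- A bound on the error probability of the DD algorithm for a fixed defective set. -/
theorem bernoulliDesign_real_ddEstimate_ne_le (p : I) (D : Finset (Fin N)) {a : ℝ} (ha : 0 < a) :
    (bernoulliDesign N T p).real {X | ddEstimate X (outcome X D) ≠ D} ≤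
      N / a * (1 - p * (1 - p) ^ D.card) ^ T +
        D.card * (1 - p * (1 - p) ^ D.card * (1 - p * a)) ^ T := by
  have : IsProbabilityMeasure (bernoulliDesign N T p) := by
    unfold bernoulliDesign; infer_instance
  have hsub : {X : TestMatrix N T | ddEstimate X (outcome X D) ≠ D} ⊆
      {X | a < ((possibleDefectives X (outcome X D) \ D).card : ℝ)} ∪
        ⋃ i ∈ D, {X | ((possibleDefectives X (outcome X D) \ D).card : ℝ) ≤ a ∧
          i ∉ ddEstimate X (outcome X D)} := by
    intro X hX
    rcases lt_or_ge a ((possibleDefectives X (outcome X D) \ D).card : ℝ) with h | h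
    · exact Or.inl h
    · right
      have : ¬ D ⊆ ddEstimate X (outcome X D) := fun h' => hX ((ddEstimate_subset X D).antisymm h')
      obtain ⟨i, hi, hi'⟩ := Finset.not_subset.1 this
      simp only [Set.mem_iUnion]
      exact ⟨i, hi, h, hi'⟩
  refine (measureReal_mono hsub).trans ((measureReal_union_le _ _).trans (add_le_add
    (bernoulliDesign_real_lt_card_le p D ha) ((measureReal_biUnion_finset_le _ _).trans ?_)))
  refine (Finset.sum_le_sum fun i hi =>
    bernoulliDesign_real_notMem_ddEstimate_le p D hi ha.le).trans ?_
  rw [Finset.sum_const, nsmul_eq_mul]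

end Algorithm

/-! ### Averaging over defective sets and asymptotics -/

lemma averageErrorProb_nonneg {N T : ℕ}
    (alg : TestMatrix N T → (Fin T → Bool) → Finset (Fin N)) (K : ℕ) (p : I) :
    0 ≤ averageErrorProb alg K p :=
  mul_nonneg (by positivity) (Finset.sum_nonneg fun _ _ => measureReal_nonneg)

/-- Uniform bounds over the defective set bound the average error probability. -/
lemma averageErrorProb_le {N T : ℕ}
    (alg : TestMatrix N T → (Fin T → Bool) → Finset (Fin N)) (K : ℕ) (p : I) {b : ℝ} (hb0 : 0 ≤ b)
    (hb : ∀ D : Finset (Fin N), D.card = K →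
      (bernoulliDesign N T p).real {X | alg X (outcome X D) ≠ D} ≤ b) :
    averageErrorProb alg K p ≤ b := by
  have h : ∑ D ∈ Finset.powersetCard K (Finset.univ : Finset (Fin N)),
      (bernoulliDesign N T p).real {X | alg X (outcome X D) ≠ D} ≤ N.choose K * b := by
    refine (Finset.sum_le_sum fun D hD => hb D (Finset.mem_powersetCard.1 hD).2).trans ?_
    simp
  rw [averageErrorProb, one_div_mul_eq_div]
  -- If `K > N` the quotient is zero by convention, and `0 ≤ b` suffices.
  exact div_le_of_le_mul₀ (Nat.cast_nonneg _) hb0 (h.trans_eq (mul_comm _ _))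

/-- With `K` defective items and `p = 1 / K`, the error probability of the DD algorithm is
exponentially small in the number of tests. -/
lemma averageErrorProb_ddEstimate_le {N T K : ℕ} (hK : 0 < K) {η : ℝ} (hη0 : 0 < η)
    (hη1 : η ≤ 1) :
    averageErrorProb (N := N) (T := T) ddEstimate K (oneDiv K) ≤
      (N / (η * K) + K) * Real.exp (-((1 - 1 / K) ^ K * (1 - η) * (T / K))) := by
  have hK' : (0 : ℝ) < K := Nat.cast_pos.2 hK
  refine averageErrorProb_le _ _ _ (by positivity) fun D hD => ?_
  refine (bernoulliDesign_real_ddEstimate_ne_le (oneDiv K) D (mul_pos hη0 hK')).trans ?_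
  have hp : ((oneDiv K : I) : ℝ) = 1 / K := rfl
  rw [hp, hD, add_mul]
  have hK1 : 1 / (K : ℝ) ≤ 1 := by rw [one_div]; exact Nat.cast_inv_le_one K
  have hr0 : 0 ≤ (1 - 1 / (K : ℝ)) ^ K := pow_nonneg (by linarith) _
  have hr1 : (1 - 1 / (K : ℝ)) ^ K ≤ 1 := pow_le_one₀ (by linarith) (by simp)
  have hpη : 1 / (K : ℝ) * (η * K) = η := by field_simp
  have hpow : ∀ x : ℝ, 0 ≤ x → x ≤ 1 → (1 - 1 / (K : ℝ) * (1 - 1 / K) ^ K * x) ^ T ≤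
      Real.exp (-((1 - 1 / K) ^ K * x * (T / K))) := by
    intro x hx0 hx1
    have h0 : 0 ≤ 1 - 1 / (K : ℝ) * (1 - 1 / K) ^ K * x := by
      have := mul_le_one₀ (mul_le_one₀ hK1 hr0 hr1) hx0 hx1
      linarith
    refine (pow_le_pow_left₀ h0 (Real.one_sub_le_exp_neg _) T).trans_eq ?_
    rw [← Real.exp_nat_mul]
    congr 1
    ring
  have h1 := hpow 1 zero_le_one le_rfl
  have h2 := hpow (1 - η) (by linarith) (by linarith)
  rw [mul_one, mul_one] at h1
  have h3 : Real.exp (-((1 - 1 / (K : ℝ)) ^ K * (T / K))) ≤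
      Real.exp (-((1 - 1 / K) ^ K * (1 - η) * (T / K))) := by
    refine Real.exp_le_exp.2 (neg_le_neg ?_)
    refine mul_le_mul_of_nonneg_right ?_ (by positivity)
    exact mul_le_of_le_one_right hr0 (by linarith)
  rw [hpη]
  gcongr
  exact h1.trans h3

theorem mainTheorem4 (β δ : ℝ) (hβ0 : 0 < β) (hβ1 : β < 1) (hδ : 0 < δ)
    (K T : ℕ → ℕ)
    (hK : ∀ N : ℕ, |(K N : ℝ) - (N : ℝ) ^ (1 - β)| < 1)
    (hT : ∀ N : ℕ,
      |(T N : ℝ) - (max β (1 - β) + δ) * Real.exp 1 * (K N : ℝ) * Real.log (N : ℝ)| < 1) :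
    Tendsto (fun N : ℕ => successProb (N := N) (T := T N) ddEstimate (K N) (oneDiv (K N)))
      atTop (𝓝 1) := by
  set m := max β (1 - β) with hm
  have hmβ : β ≤ m := le_max_left _ _
  have hmβ' : 1 - β ≤ m := le_max_right _ _
  have hpow : Tendsto (fun N : ℕ => (N : ℝ) ^ (1 - β)) atTop atTop :=
    (tendsto_rpow_atTop (by linarith)).comp tendsto_natCast_atTop_atTop
  have hKtop : Tendsto K atTop atTop := by
    rw [← tendsto_natCast_atTop_iff (R := ℝ)]
    refine tendsto_atTop_mono (fun N => ?_) (tendsto_atTop_add_const_right _ (-1) hpow)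
    have := (abs_lt.1 (hK N)).1
    linarith
  -- `η` is chosen so that replacing `δ` by `δ / 2` leaves room for a factor `(1 - η) ^ 2`
  set η : ℝ := δ / (4 * (m + δ)) with hη
  have hmδ : 0 < m + δ := by linarith
  have hη0 : 0 < η := by positivity
  have hηm : η * (m + δ) = δ / 4 := by rw [hη]; field_simp
  have hη1 : η ≤ 1 := by
    rw [hη, div_le_one (by positivity)]; linarith
  have hlim : Tendsto (fun N => (1 - 1 / (K N : ℝ)) ^ K N) atTop (𝓝 (Real.exp (-1))) := by
    have := (Real.tendsto_one_add_div_pow_exp (-1)).comp hKtop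
    refine this.congr fun N => ?_
    simp only [Function.comp, neg_div, ← sub_eq_add_neg]
  have hlim' : ∀ᶠ N in atTop, Real.exp (-1) * (1 - η) < (1 - 1 / (K N : ℝ)) ^ K N :=
    hlim.eventually_const_lt (by nlinarith [Real.exp_pos (-1)])
  have hbound : ∀ᶠ N : ℕ in atTop,
      averageErrorProb (N := N) (T := T N) ddEstimate (K N) (oneDiv (K N)) ≤
        (2 / η + 2) * Real.exp 1 * (N : ℝ) ^ (-(δ / 2)) := by
    filter_upwards [hlim', hpow.eventually_ge_atTop 2, hKtop.eventually_gt_atTop 0,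
      eventually_gt_atTop 0] with N hr hN hK0 hN0
    have hN1 : (1 : ℝ) ≤ N := by exact_mod_cast hN0
    have hNpos : (0 : ℝ) < N := by linarith
    have hlog : 0 ≤ Real.log N := Real.log_nonneg hN1
    have hKN := abs_lt.1 (hK N)
    have hTN := (abs_lt.1 (hT N)).1
    have hK1 : (1 : ℝ) ≤ K N := by exact_mod_cast hK0
    have hKpos : (0 : ℝ) < K N := by linarith
    -- Once `N^(1-β) ≥ 2`, rounding changes it by at most a factor of two.
    have hKl : (N : ℝ) ^ (1 - β) / 2 ≤ K N := by linarith
    have hKu : (K N : ℝ) ≤ 2 * (N : ℝ) ^ (1 - β) := by linarith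
    refine (averageErrorProb_ddEstimate_le hK0 hη0 hη1).trans ?_
    have hr1 : (1 - 1 / (K N : ℝ)) ^ K N ≤ 1 := by
      have : 1 / (K N : ℝ) ≤ 1 := (div_le_one hKpos).2 hK1
      exact pow_le_one₀ (by linarith) (by simp)
    have hr0 : 0 ≤ (1 - 1 / (K N : ℝ)) ^ K N := by
      refine le_trans ?_ hr.le
      exact mul_nonneg (Real.exp_pos _).le (by linarith)
    -- The `-1` absorbs the rounding of `T`. One factor `1 - η` is already present and the other
    -- comes from `hlim'`; `(1-η)^2 (m+δ) ≥ m + δ - 2 * (δ/4)`.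
    have hexp : (m + δ / 2) * Real.log N - 1 ≤
        (1 - 1 / (K N : ℝ)) ^ K N * (1 - η) * (T N / K N) := by
      have h1 : (m + δ) * Real.exp 1 * Real.log N - 1 ≤ T N / K N := by
        rw [le_div_iff₀ hKpos]
        nlinarith
      have hc0 : 0 ≤ (1 - 1 / (K N : ℝ)) ^ K N * (1 - η) := mul_nonneg hr0 (by linarith)
      have hc1 : (1 - 1 / (K N : ℝ)) ^ K N * (1 - η) ≤ 1 :=
        mul_le_one₀ hr1 (by linarith) (by linarith)
      refine le_trans ?_ (mul_le_mul_of_nonneg_left h1 hc0)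
      have h2 : m + δ / 2 ≤ (1 - 1 / (K N : ℝ)) ^ K N * (1 - η) * ((m + δ) * Real.exp 1) := by
        have h3 : Real.exp (-1) * (1 - η) * (1 - η) * ((m + δ) * Real.exp 1) ≤
            (1 - 1 / (K N : ℝ)) ^ K N * (1 - η) * ((m + δ) * Real.exp 1) := by
          have : 0 ≤ 1 - η := by linarith
          gcongr
        refine le_trans ?_ h3
        have h4 : Real.exp (-1) * Real.exp 1 = 1 := by rw [← Real.exp_add]; simp
        have h5 : Real.exp (-1) * (1 - η) * (1 - η) * ((m + δ) * Real.exp 1) =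
            (Real.exp (-1) * Real.exp 1) * ((m + δ) - 2 * (η * (m + δ)) + η * (η * (m + δ))) := by
          ring
        rw [h5, h4, hηm, one_mul]
        nlinarith
      nlinarith [mul_le_mul_of_nonneg_right h2 hlog]
    have hexp' : Real.exp (-((1 - 1 / (K N : ℝ)) ^ K N * (1 - η) * (T N / K N))) ≤
        Real.exp 1 * (N : ℝ) ^ (-(m + δ / 2)) := by
      rw [Real.rpow_def_of_pos hNpos, ← Real.exp_add]
      refine Real.exp_le_exp.2 ?_
      linarith
    have hfac : (N : ℝ) / (η * K N) + K N ≤ (2 / η + 2) * (N : ℝ) ^ m := by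
      rw [add_mul]
      have h1 : (N : ℝ) ^ (1 - β) ≤ (N : ℝ) ^ m := Real.rpow_le_rpow_of_exponent_le hN1 hmβ'
      have h2 : (N : ℝ) ^ β ≤ (N : ℝ) ^ m := Real.rpow_le_rpow_of_exponent_le hN1 hmβ
      have h3 : (N : ℝ) ^ β * (N : ℝ) ^ (1 - β) = N := by
        rw [← Real.rpow_add hNpos]; simp
      refine add_le_add ?_ (by linarith)
      rw [div_le_iff₀ (by positivity)]
      have h4 : 2 / η * (N : ℝ) ^ m * (η * K N) = (N : ℝ) ^ m * (2 * K N) := by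
        field_simp
      rw [h4]
      calc (N : ℝ) = (N : ℝ) ^ β * (N : ℝ) ^ (1 - β) := h3.symm
        _ ≤ (N : ℝ) ^ m * (2 * K N) := by gcongr; linarith
    calc _ ≤ (2 / η + 2) * (N : ℝ) ^ m * (Real.exp 1 * (N : ℝ) ^ (-(m + δ / 2))) := by
          gcongr
      _ = (2 / η + 2) * Real.exp 1 * ((N : ℝ) ^ m * (N : ℝ) ^ (-(m + δ / 2))) := by ring
      _ = _ := by rw [← Real.rpow_add hNpos]; ring_nf
  have hzero : Tendsto (fun N : ℕ => (2 / η + 2) * Real.exp 1 * (N : ℝ) ^ (-(δ / 2)))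
      atTop (𝓝 0) := by
    have := ((tendsto_rpow_neg_atTop (half_pos hδ)).comp
      tendsto_natCast_atTop_atTop).const_mul ((2 / η + 2) * Real.exp 1)
    rwa [mul_zero] at this
  have herr := squeeze_zero' (Eventually.of_forall fun N =>
    averageErrorProb_nonneg (N := N) (T := T N) ddEstimate (K N) (oneDiv (K N))) hbound hzero
  simpa [successProb] using herr.const_sub 1
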